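/- All graphs are finite and simple. For a connected graph $G$ with at least two vertices, Kemeny's constant is $\mathscr{K}(G)=\sum_j \pi_j m_{ij}$, where $\pi$ is the stationary distribution of the simple random walk on $G$ and $m_{ij}$ is the expected hitting time of $j$ for the walk started at $i$ (with $m_{jj}=0$); this value is finite and does not depend on $i$. A Braess edge of $G$ is a pair $e=\{a,b\}$ of distinct non-adjacent vertices such that $\mathscr{K}(G+e)>\mathscr{K}(G)$. For graphs $G_1,G_2$ with chosen vertices $v_1,v_2$, the 1-sum $G_1\oplus_{v_1,v_2}G_2$ is obtained from the disjoint union by identifying $v_1$ with $v_2$. Let $K_n\oplus P_n$ be the 1-sum of the complete graph $K_n$ (at any vertex) and the path $P_n$ on $n$ vertices (at one of its ends), and let $w_n$ be the other end of the path. Let $G_2$ be a connected graph. 1. For every vertex $v$ of $G_2$ and every pair $e=\{a,b\}$ of distinct non-adjacent vertices of $G_2$ there is an $N$ such that for all $n\ge N$ with $n \ge 1$, $e$ is a Braess edge of $(K_n\oplus P_n)\oplus_{w_n,v}G_2$. 2. In particular, there are a connected graph $G_1$ and a vertex $v_1$ of $G_1$ such that for every vertex $v$ of $G_2$, every pair of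 distinct non-adjacent vertices of $G_2$ is a Braess edge of $G_1\oplus_{v_1,v}G_2$. -/

import Mathlib

open scoped NNReal ENNReal

noncomputable section

namespace Kemeny

/-! ### Markov chains on a finite state space -/

/-- `π` is a stationary (probability) distribution of the chain with transition matrix `P`. -/
structure IsStationary {V : Type*} [Fintype V] (P : V → V → ℝ≥0) (π : V → ℝ≥0) : Prop where
  sum_eq_one : ∑ i, π i = 1
  stationary : ∀ j, ∑ i, π i * P i j = π j

open scoped Classical in
/-- The probability that the chain `X₀, X₁, …` with transition matrix `P`, started at `X₀ = i`,
satisfies `X₀ ≠ j, …, X_t ≠ j`: the sum, over all trajectories `x₀, …, x_t` with `x₀ = i` that avoid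
`j`, of their probabilities `P x₀ x₁ * ⋯ * P x_{t-1} x_t`. -/
def avoidProb {V : Type*} [Fintype V] (P : V → V → ℝ≥0) (i j : V) (t : ℕ) : ℝ≥0 :=
  ∑ x : Fin (t + 1) → V with x 0 = i ∧ ∀ s, x s ≠ j,
    ∏ s : Fin t, P (x s.castSucc) (x s.succ)

/-- The expected hitting time `m_{ij}` of `j` for the chain started at `i`, that is the expectation
`E T = ∑_{t ≥ 0} Prob (T > t)` of `T = min {t ≥ 0 | X_t = j}` (so that `m_{jj} = 0`). Its values
are in `[0, ∞]`, hence the sum always has its true value. -/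
def hittingTime {V : Type*} [Fintype V] (P : V → V → ℝ≥0) (i j : V) : ℝ≥0∞ :=
  ∑' t : ℕ, (avoidProb P i j t : ℝ≥0∞)

/-- Kemeny's constant of the chain `P` is well defined and equals the (finite) number `κ`: there is
exactly one stationary distribution `π`, and `∑ j, π j * m_{ij} = κ` for every initial state `i`. -/
def HasKemenyConstant {V : Type*} [Fintype V] (P : V → V → ℝ≥0) (κ : ℝ≥0) : Prop :=
  (∃! π : V → ℝ≥0, IsStationary P π) ∧
    ∀ π : V → ℝ≥0, IsStationary P π →
      ∀ i, ∑ j, (π j : ℝ≥0∞) * hittingTime P i j = (κ : ℝ≥0∞)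

/-! ### Graphs -/

open scoped Classical in
/-- The transition matrix of the simple random walk on `G`: from `i`, move to a uniformly chosen
neighbour of `i`. -/
def walkMatrix {V : Type*} [Fintype V] (G : SimpleGraph V) (i j : V) : ℝ≥0 :=
  if G.Adj i j then 1 / (G.degree i : ℝ≥0) else 0

/-- `{a, b}` is a Braess edge of `G`: a non-edge of `G` such that adding it to `G` strictly increases
Kemeny's constant (of the simple random walk). -/
def IsBraessEdge {V : Type*} [Fintype V] (G : SimpleGraph V) (a b : V) : Prop :=
  a ≠ b ∧ ¬ G.Adj a b ∧
    ∃ κ κ' : ℝ≥0, HasKemenyConstant (walkMatrix G) κ ∧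
      HasKemenyConstant (walkMatrix (G ⊔ SimpleGraph.edge a b)) κ' ∧ κ < κ'

/-- Vertices of the 1-sum: those of the first graph except `v₁`, and those of the second graph. -/
abbrev OneSumVert {V₁ : Type*} (v₁ : V₁) (V₂ : Type*) : Type _ := {x : V₁ // x ≠ v₁} ⊕ V₂

/-- The 1-sum of `G₁` and `G₂` at `v₁` and `v₂`: take the disjoint union, remove `v₁`, and replace
each edge `{i, v₁}` of `G₁` by `{i, v₂}`. -/
def oneSum {V₁ V₂ : Type*} (G₁ : SimpleGraph V₁) (v₁ : V₁) (G₂ : SimpleGraph V₂) (v₂ : V₂) :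
    SimpleGraph (OneSumVert v₁ V₂) where
  Adj
    | .inl x, .inl y => G₁.Adj x y
    | .inl x, .inr y => G₁.Adj x v₁ ∧ y = v₂
    | .inr x, .inl y => G₁.Adj y v₁ ∧ x = v₂
    | .inr x, .inr y => G₂.Adj x y
  symm := ⟨by
    rintro (x | x) (y | y) h
    · exact SimpleGraph.Adj.symm (G := G₁) h
    · exact h
    · exact h
    · exact SimpleGraph.Adj.symm (G := G₂) h⟩
  loopless := ⟨by
    rintro (x | x) h
    · exact G₁.irrefl h
    · exact G₂.irrefl h⟩

/-- Vertices of `K_n ⊕ P_n`. -/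
abbrev CliquePathVert (n : ℕ) [NeZero n] : Type := OneSumVert (0 : Fin n) (Fin n)

/-- The graph `K_n ⊕ P_n`: a vertex of the complete graph `K_n` is identified with the last vertex
`Fin.rev 0 = n - 1` of the path `P_n = (0, 1, …, n - 1)`. -/
def cliquePath (n : ℕ) [NeZero n] : SimpleGraph (CliquePathVert n) :=
  oneSum (⊤ : SimpleGraph (Fin n)) 0 (SimpleGraph.pathGraph n) (Fin.rev 0)

/-- The free end of the path in `K_n ⊕ P_n`. -/
def freeEnd (n : ℕ) [NeZero n] : CliquePathVert n := Sum.inr 0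

end Kemeny

end

/-! For a resistance function `R`, Kemeny's constant is `energy G R / (2 * vol G 1)`
(`hasKemenyConstant_of_isResistance`). Both quantities split over a 1-sum: if p, q are the volumes
of the summands, D₁, D their energies and A, B their degree-weighted sums of resistances to and from
the glued vertex, then the volume is p + q and the energy is D₁ + qA + pB + D (`energy_oneSum`).

A new edge in the second summand raises q by 2 and changes B and D by amounts independent of the
first. After clearing denominators the gain is 2pA - 2D₁ plus a quadratic in p whose coefficients
depend only on the second summand (`energy_comparison`). The first summand should thus have its
volume far from the glued vertex but concentrated. In K_n ⊕ P_n nearly all volume lies in the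
clique, at distance n - 1 from the free end: p ~ n² and A ≥ 2n(n - 1)², so 2pA is at least about
4n⁵, while 2D₁ ≤ 2np² ~ 2n⁵ and the quadratic is O(n⁴).

On a connected graph `IsResistance` fixes `R` only up to adding u x - u y. This term cancels in the
energy, in `R x v + R v x` and in the hitting times, so `R` need not be symmetric. -/

open scoped NNReal ENNReal

noncomputable section

namespace Kemeny

/-! ### Hitting times from one-step equations -/

section Markov

variable {V : Type*} [Fintype V]

lemma avoidProb_self (P : V → V → ℝ≥0) (j : V) (t : ℕ) : avoidProb P j j t = 0 := by
  unfold avoidProb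
  apply Finset.sum_eq_zero
  intro x hx
  simp only [Finset.mem_filter, Finset.mem_univ, true_and] at hx
  exact absurd hx.1 (hx.2 0)

lemma avoidProb_zero (P : V → V → ℝ≥0) {i j : V} (hij : i ≠ j) : avoidProb P i j 0 = 1 := by
  classical
  unfold avoidProb
  rw [Finset.sum_eq_single (fun _ => i)]
  · simp
  · intro x hx hne
    simp only [Finset.mem_filter, Finset.mem_univ, true_and] at hx
    refine absurd (funext fun s => ?_) hne
    rw [show s = 0 from Fin.ext (by omega), hx.1]
  · intro h
    simp [hij] at h

lemma avoidProb_succ (P : V → V → ℝ≥0) {i j : V} (hij : i ≠ j) (t : ℕ) :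
    avoidProb P i j (t + 1) = ∑ k, P i k * avoidProb P k j t := by
  classical
  unfold avoidProb
  simp only [Finset.sum_filter, Finset.mul_sum]
  rw [← (Fin.consEquiv (fun _ : Fin (t + 1 + 1) => V)).sum_comp, Fintype.sum_prod_type,
    Finset.sum_eq_single i, Finset.sum_comm]
  · refine Finset.sum_congr rfl fun x _ => ?_
    rw [Finset.sum_eq_single (x 0)]
    · have h : (∀ s, (Fin.cons i x : Fin (t + 1 + 1) → V) s ≠ j) ↔ ∀ s, x s ≠ j := by
        simp [Fin.forall_fin_succ (n := t + 1), hij]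
      simp only [Fin.consEquiv_apply, Fin.cons_zero, true_and, h, mul_ite, mul_zero]
      refine if_congr Iff.rfl ?_ rfl
      rw [Fin.prod_univ_succ]
      simp
    · intro k _ hk
      rw [if_neg (fun h => hk h.1.symm), mul_zero]
    · simp
  · intro k _ hk
    refine Finset.sum_eq_zero fun x _ => if_neg fun h => hk ?_
    simpa using h.1
  · simp

/-- Minimum principle: at a minimum other than `j`, the average over successors is at least `h`
there, so the equation would give `h ≥ 1 + h`. -/
lemma nonneg_of_eq_one_add {P : V → V → ℝ≥0} (hP : ∀ i, ∑ k, P i k = 1) {j : V} {h : V → ℝ}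
    (hj : h j = 0) (hh : ∀ i, i ≠ j → h i = 1 + ∑ k, (P i k : ℝ) * h k) (i : V) : 0 ≤ h i := by
  have : Nonempty V := ⟨j⟩
  obtain ⟨x, hx⟩ := Finite.exists_min h
  by_cases hxj : x = j
  · rw [← hj, ← hxj]; exact hx i
  · have h1 : ∑ k, (P x k : ℝ) * h x ≤ ∑ k, (P x k : ℝ) * h k :=
      Finset.sum_le_sum fun k _ => mul_le_mul_of_nonneg_left (hx k) (P x k).2
    have h2 : ∑ k, (P x k : ℝ) = 1 := by exact_mod_cast hP x
    rw [← Finset.sum_mul, h2] at h1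
    linarith [hh x hxj]

/-- Unrolling the equation for `t` steps leaves the mean of `h` over trajectories still avoiding
`j`, which lies between 0 and `C * avoidProb P i j t`. The lower bound makes the series summable;
hence `avoidProb` tends to 0 and the upper bound closes the squeeze. -/
lemma hittingTime_eq_ofReal {P : V → V → ℝ≥0} (hP : ∀ i, ∑ k, P i k = 1) {j : V} {h : V → ℝ}
    (hj : h j = 0) (hh : ∀ i, i ≠ j → h i = 1 + ∑ k, (P i k : ℝ) * h k) (i : V) :
    hittingTime P i j = ENNReal.ofReal (h i) := by
  have h0 := nonneg_of_eq_one_add hP hj hh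
  obtain ⟨C, hC⟩ : ∃ C, ∀ k, h k ≤ C := by
    have : Nonempty V := ⟨j⟩
    obtain ⟨x, hx⟩ := Finite.exists_max h
    exact ⟨h x, hx⟩
  have key : ∀ (t : ℕ) (i : V),
      0 ≤ h i - ∑ s ∈ Finset.range t, (avoidProb P i j s : ℝ) ∧
        h i - ∑ s ∈ Finset.range t, (avoidProb P i j s : ℝ) ≤ C * avoidProb P i j t := by
    intro t
    induction t with
    | zero =>
      intro i
      by_cases hij : i = j
      · subst hij; simp [avoidProb_self, hj]
      · simp [avoidProb_zero P hij, h0 i, hC i]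
    | succ t ih =>
      intro i
      by_cases hij : i = j
      · subst hij; simp [avoidProb_self, hj]
      · have e : h i - ∑ s ∈ Finset.range (t + 1), (avoidProb P i j s : ℝ) =
            ∑ k, (P i k : ℝ) * (h k - ∑ s ∈ Finset.range t, (avoidProb P k j s : ℝ)) := by
          rw [Finset.sum_range_succ', avoidProb_zero P hij, hh i hij]
          simp only [avoidProb_succ P hij, mul_sub, Finset.sum_sub_distrib, Finset.mul_sum]
          push_cast
          rw [Finset.sum_comm]
          ring
        rw [e]
        constructor
        · exact Finset.sum_nonneg fun k _ => mul_nonneg (P i k).2 (ih k).1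
        · rw [avoidProb_succ P hij]
          push_cast
          rw [Finset.mul_sum]
          refine Finset.sum_le_sum fun k _ => ?_
          have := mul_le_mul_of_nonneg_left (ih k).2 (P i k).2
          calc _ ≤ _ := this
            _ = _ := by simp only [NNReal.val_eq_coe]; ring
  have hsum : Summable fun s => (avoidProb P i j s : ℝ) :=
    summable_of_sum_range_le (c := h i) (fun s => (avoidProb P i j s).2) fun t => by
      linarith [(key t i).1]
  have hlim : Filter.Tendsto (fun t => ∑ s ∈ Finset.range t, (avoidProb P i j s : ℝ))
      Filter.atTop (nhds (h i)) := by
    have h1 : Filter.Tendsto (fun t => h i - C * avoidProb P i j t) Filter.atTop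
        (nhds (h i - C * 0)) := (hsum.tendsto_atTop_zero.const_mul C).const_sub _
    rw [mul_zero, sub_zero] at h1
    exact tendsto_of_tendsto_of_tendsto_of_le_of_le h1 tendsto_const_nhds
      (fun t => by linarith [(key t i).2]) (fun t => by linarith [(key t i).1])
  have htsum := tendsto_nhds_unique hsum.hasSum.tendsto_sum_nat hlim
  unfold hittingTime
  rw [← htsum, ENNReal.ofReal_tsum_of_nonneg (f := fun s => (avoidProb P i j s : ℝ))
    (fun s => NNReal.coe_nonneg _) hsum]
  simp

end Markov

/-! ### Degree-weighted sums and resistance functions -/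

section EdgeSum

variable {V : Type*} [Fintype V]

open scoped Classical in
/-- The sum of `F x y` over all ordered pairs of adjacent vertices. -/
def edgeSum (G : SimpleGraph V) (F : V → V → ℝ) : ℝ :=
  ∑ x, ∑ y, if G.Adj x y then F x y else 0

/-- The sum of `f` over the vertices, weighted with their degrees. -/
def vol (G : SimpleGraph V) (f : V → ℝ) : ℝ := edgeSum G fun x _ => f x

/-- `R` vanishes on the diagonal, and its Laplacian in the first variable is, up to a term that does
not depend on `k`, equal to `-2` times the point mass at `k`; it is given here in weak form. -/
structure IsResistance (G : SimpleGraph V) (R : V → V → ℝ) : Prop where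
  diag : ∀ k, R k k = 0
  weak : ∃ c : (V → ℝ) → ℝ, ∀ φ k,
    edgeSum G (fun x y => φ x * (R x k - R y k)) = c φ - 2 * φ k

/-- The sum of `R x y` weighted with the products of the degrees. -/
def energy (G : SimpleGraph V) (R : V → V → ℝ) : ℝ := vol G fun x => vol G fun y => R x y

lemma edgeSum_add (G : SimpleGraph V) (F F' : V → V → ℝ) :
    edgeSum G (fun x y => F x y + F' x y) = edgeSum G F + edgeSum G F' := by
  classical
  simp only [edgeSum, ← Finset.sum_add_distrib]
  refine Finset.sum_congr rfl fun x _ => Finset.sum_congr rfl fun y _ => ?_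
  split_ifs <;> simp

lemma edgeSum_mul (G : SimpleGraph V) (c : ℝ) (F : V → V → ℝ) :
    edgeSum G (fun x y => c * F x y) = c * edgeSum G F := by
  classical
  simp only [edgeSum, Finset.mul_sum, mul_ite, mul_zero]

lemma edgeSum_mono (G : SimpleGraph V) {F F' : V → V → ℝ} (h : ∀ x y, F x y ≤ F' x y) :
    edgeSum G F ≤ edgeSum G F' := by
  classical
  refine Finset.sum_le_sum fun x _ => Finset.sum_le_sum fun y _ => ?_
  split_ifs
  · exact h x y
  · exact le_rfl

lemma edgeSum_swap (G : SimpleGraph V) (F : V → V → ℝ) :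
    edgeSum G (fun x y => F y x) = edgeSum G F := by
  classical
  unfold edgeSum
  rw [Finset.sum_comm]
  simp only [G.adj_comm]

lemma vol_add (G : SimpleGraph V) (f g : V → ℝ) :
    vol G (fun x => f x + g x) = vol G f + vol G g := edgeSum_add _ _ _

lemma vol_mul (G : SimpleGraph V) (c : ℝ) (f : V → ℝ) :
    vol G (fun x => c * f x) = c * vol G f := edgeSum_mul _ _ _

lemma vol_const (G : SimpleGraph V) (c : ℝ) : vol G (fun _ => c) = c * vol G 1 := by
  rw [← vol_mul]; simp

lemma vol_mono (G : SimpleGraph V) {f g : V → ℝ} (h : ∀ x, f x ≤ g x) : vol G f ≤ vol G g :=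
  edgeSum_mono _ fun x _ => h x

open scoped Classical in
lemma vol_eq_sum (G : SimpleGraph V) (f : V → ℝ) : vol G f = ∑ x, (G.degree x : ℝ) * f x := by
  unfold vol edgeSum
  refine Finset.sum_congr rfl fun x _ => ?_
  rw [← Finset.sum_filter, Finset.sum_const, nsmul_eq_mul, ← G.neighborFinset_eq_filter,
    G.card_neighborFinset_eq_degree]

open scoped Classical in
lemma edgeSum_single (G : SimpleGraph V) (i : V) (F : V → V → ℝ) :
    edgeSum G (fun x y => (Pi.single i 1 : V → ℝ) x * F x y) =
      ∑ y, if G.Adj i y then F i y else 0 := by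
  unfold edgeSum
  rw [Finset.sum_eq_single i]
  · simp
  · intro x _ hx
    simp [hx]
  · simp

end EdgeSum

/-! ### Kemeny's constant of the simple random walk -/

section Walk

variable {V : Type*} [Fintype V]

open scoped Classical in
lemma sum_walkMatrix_mul (G : SimpleGraph V) (i : V) (f : V → ℝ) :
    ∑ k, (walkMatrix G i k : ℝ) * f k = (∑ k, if G.Adj i k then f k else 0) / G.degree i := by
  rw [Finset.sum_div]
  refine Finset.sum_congr rfl fun k _ => ?_
  unfold walkMatrix
  split_ifs
  · push_cast; ring
  · simp

open scoped Classical in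
lemma sum_adj_const (G : SimpleGraph V) (i : V) (c : ℝ) :
    (∑ k, if G.Adj i k then c else 0) = G.degree i * c := by
  rw [← Finset.sum_filter, Finset.sum_const, nsmul_eq_mul, ← G.neighborFinset_eq_filter,
    G.card_neighborFinset_eq_degree]

open scoped Classical in
lemma sum_walkMatrix (G : SimpleGraph V) {i : V} (hi : 0 < G.degree i) :
    ∑ k, walkMatrix G i k = 1 := by
  have h := sum_walkMatrix_mul G i 1
  simp only [Pi.one_apply, mul_one, sum_adj_const] at h
  rw [div_self (by positivity)] at h
  exact_mod_cast h

/-- Kemeny's constant in terms of resistances. -/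
theorem hasKemenyConstant_of_isResistance [Nonempty V] {G : SimpleGraph V}
    (hG : ∀ x, ∃ y, G.Adj x y) {R : V → V → ℝ} (hR : IsResistance G R) :
    ∃ κ : ℝ≥0, HasKemenyConstant (walkMatrix G) κ ∧ (κ : ℝ) = energy G R / (2 * vol G 1) := by
  classical
  have hd : ∀ x, 0 < G.degree x := fun x => by
    obtain ⟨y, hy⟩ := hG x
    exact (G.degree_pos_iff_exists_adj x).2 ⟨y, hy⟩
  have hd' : ∀ x, (G.degree x : ℝ) ≠ 0 := fun x => by exact_mod_cast (hd x).ne'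
  have hP : ∀ x, ∑ k, walkMatrix G x k = 1 := fun x => sum_walkMatrix G (hd x)
  have hP' : ∀ x, ∑ k, (walkMatrix G x k : ℝ) = 1 := fun x => by exact_mod_cast hP x
  set m : ℝ := vol G 1 with hm
  have hm' : m = ∑ x, (G.degree x : ℝ) := by simp [hm, vol_eq_sum]
  have hm0 : 0 < m := by
    rw [hm']
    exact Finset.sum_pos (fun x _ => by exact_mod_cast hd x) Finset.univ_nonempty
  obtain ⟨c, hc⟩ := hR.weak
  -- The weak form, tested against the point mass at `i`.
  have hlap : ∀ i k, R i k - ∑ y, (walkMatrix G i y : ℝ) * R y k =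
      (c (Pi.single i 1) - 2 * (Pi.single i 1 : V → ℝ) k) / G.degree i := by
    intro i k
    rw [← hc, edgeSum_single, sum_walkMatrix_mul, eq_div_iff (hd' i), sub_mul,
      div_mul_cancel₀ _ (hd' i), mul_comm, ← sum_adj_const, ← Finset.sum_sub_distrib]
    refine Finset.sum_congr rfl fun y _ => ?_
    split_ifs <;> simp
  -- The classical expression of hitting times by resistances. The order of the arguments matters,
  -- as `R` may fail to be symmetric.
  set h : V → V → ℝ := fun i j => (1 / 2) * vol G (fun k => R i j + R j k - R i k) with hh
  have hvol : ∀ i j, h i j = (1 / 2) * (m * R i j + vol G (R j) - vol G (R i)) := by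
    intro i j
    have e : (fun k => R i j + R j k - R i k) = fun k => (R i j + R j k) + (-1) * R i k := by
      funext k; ring
    simp only [hh, e, vol_add, vol_mul, vol_const]
    ring
  have hself : ∀ j, h j j = 0 := fun j => by rw [hvol, hR.diag]; ring
  have hvolR : ∀ i, vol G (R i) - ∑ y, (walkMatrix G i y : ℝ) * vol G (R y) =
      m * (c (Pi.single i 1) / G.degree i) - 2 := by
    intro i
    have e1 : vol G (R i) - ∑ y, (walkMatrix G i y : ℝ) * vol G (R y) =
        ∑ k, (G.degree k : ℝ) * (R i k - ∑ y, (walkMatrix G i y : ℝ) * R y k) := by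
      simp only [vol_eq_sum, mul_sub, Finset.sum_sub_distrib, Finset.mul_sum]
      rw [Finset.sum_comm]
      congr 1
      refine Finset.sum_congr rfl fun x _ => Finset.sum_congr rfl fun y _ => ?_
      ring
    have e2 : ∀ k, (G.degree k : ℝ) * ((c (Pi.single i 1) - 2 * (Pi.single i 1 : V → ℝ) k) /
        G.degree i) = (G.degree k : ℝ) * (c (Pi.single i 1) / G.degree i) -
          (if k = i then 2 else 0) := by
      intro k
      by_cases hk : k = i
      · subst hk
        have := hd' k
        simp only [Pi.single_eq_same, if_true]
        field_simp
      · simp [hk]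
    simp only [e1, hlap, e2, Finset.sum_sub_distrib, ← Finset.sum_mul, ← hm']
    simp
  -- The unknown `c` cancels. On the diagonal, `m / G.degree i` is the mean return time.
  have hstep : ∀ i j, h i j - ∑ k, (walkMatrix G i k : ℝ) * h k j =
      1 - if i = j then m / G.degree i else 0 := by
    intro i j
    have e : h i j - ∑ k, (walkMatrix G i k : ℝ) * h k j =
        (1 / 2) * (m * (R i j - ∑ k, (walkMatrix G i k : ℝ) * R k j) -
          (vol G (R i) - ∑ k, (walkMatrix G i k : ℝ) * vol G (R k))) := by
      have e3 : ∑ k, (walkMatrix G i k : ℝ) * h k j =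
          (1 / 2) * (m * (∑ k, (walkMatrix G i k : ℝ) * R k j) +
            (∑ k, (walkMatrix G i k : ℝ)) * vol G (R j) -
            ∑ k, (walkMatrix G i k : ℝ) * vol G (R k)) := by
        simp only [hvol, Finset.mul_sum, Finset.sum_mul, ← Finset.sum_add_distrib,
          ← Finset.sum_sub_distrib]
        exact Finset.sum_congr rfl fun k _ => by ring
      rw [e3, hP', hvol]
      ring
    rw [e, hlap, hvolR]
    by_cases hij : i = j
    · subst hij
      simp only [Pi.single_eq_same, if_true]
      ring
    · simp only [hij, Ne.symm hij, Pi.single_apply, if_false]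
      ring
  have hrec : ∀ i j, i ≠ j → h i j = 1 + ∑ k, (walkMatrix G i k : ℝ) * h k j := by
    intro i j hij
    have := hstep i j
    rw [if_neg hij] at this
    linarith
  have hnn : ∀ i j, 0 ≤ h i j := fun i j =>
    nonneg_of_eq_one_add hP (h := fun i => h i j) (hself j) (fun i hij => hrec i j hij) i
  have hhit : ∀ i j, hittingTime (walkMatrix G) i j = ENNReal.ofReal (h i j) := fun i j =>
    hittingTime_eq_ofReal hP (h := fun i => h i j) (hself j) (fun i hij => hrec i j hij) i
  have huniq : ∀ π : V → ℝ≥0, IsStationary (walkMatrix G) π →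
      ∀ j, (π j : ℝ) = G.degree j / m := by
    intro π hπ j
    have h1 : ∑ i, (π i : ℝ) = 1 := by exact_mod_cast hπ.sum_eq_one
    have h2 : ∀ k, ∑ i, (π i : ℝ) * (walkMatrix G i k : ℝ) = π k := fun k => by
      exact_mod_cast hπ.stationary k
    -- Stationarity makes this pairing vanish, while `hstep` evaluates it as `1 - π j * m / G.degree
    -- j`. This pins down `π` without an appeal to irreducibility.
    have h3 : ∑ i, (π i : ℝ) * (h i j - ∑ k, (walkMatrix G i k : ℝ) * h k j) = 0 := by
      simp only [mul_sub, Finset.sum_sub_distrib, Finset.mul_sum]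
      rw [Finset.sum_comm (f := fun i k => (π i : ℝ) * ((walkMatrix G i k : ℝ) * h k j))]
      simp only [← mul_assoc, ← Finset.sum_mul, h2, sub_self]
    simp only [hstep, mul_sub, mul_one, Finset.sum_sub_distrib, h1, mul_ite, mul_zero,
      Finset.sum_ite_eq', Finset.mem_univ, if_true] at h3
    have := hd' j
    field_simp at h3 ⊢
    linarith
  let π₀ : V → ℝ≥0 := fun j => ⟨G.degree j / m, by positivity⟩
  have hπ₀ : IsStationary (walkMatrix G) π₀ := by
    constructor
    · apply NNReal.coe_injective
      push_cast
      change ∑ j, (G.degree j : ℝ) / m = 1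
      rw [← Finset.sum_div, ← hm', div_self hm0.ne']
    · intro j
      apply NNReal.coe_injective
      push_cast
      change ∑ i, (G.degree i : ℝ) / m * (walkMatrix G i j : ℝ) = (G.degree j : ℝ) / m
      have e : ∀ i, (G.degree i : ℝ) / m * (walkMatrix G i j : ℝ) =
          if G.Adj j i then 1 / m else 0 := by
        intro i
        have := hd' i
        unfold walkMatrix
        simp only [G.adj_comm j i]
        split_ifs
        · push_cast; field_simp
        · simp
      simp only [e, sum_adj_const]
      ring
  -- The terms with `vol G (R i)` cancel, which is why the start `i` disappears.
  have hκ : ∀ i, ∑ j, (G.degree j : ℝ) / m * h i j = energy G R / (2 * m) := by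
    intro i
    have e : ∀ j, (G.degree j : ℝ) / m * h i j = (1 / (2 * m)) * (m * (G.degree j * R i j) +
        G.degree j * vol G (R j) - G.degree j * vol G (R i)) := by
      intro j
      rw [hvol]
      field_simp
    have e2 : energy G R = ∑ j, (G.degree j : ℝ) * vol G (R j) := vol_eq_sum _ _
    simp only [e]
    rw [← Finset.mul_sum, Finset.sum_sub_distrib, Finset.sum_add_distrib, ← Finset.mul_sum,
      ← vol_eq_sum G (R i), ← Finset.sum_mul, ← hm', ← e2]
    ring
  have hκ0 : 0 ≤ energy G R / (2 * m) := by
    rw [← hκ (Classical.arbitrary V)]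
    exact Finset.sum_nonneg fun j _ => mul_nonneg (by positivity) (hnn _ _)
  refine ⟨⟨_, hκ0⟩, ⟨⟨π₀, hπ₀, fun π hπ => ?_⟩, fun π hπ i => ?_⟩, rfl⟩
  · funext j
    exact NNReal.coe_injective (huniq π hπ j)
  · have e : ∀ j, (π j : ℝ≥0∞) * hittingTime (walkMatrix G) i j =
        ENNReal.ofReal ((G.degree j : ℝ) / m * h i j) := by
      intro j
      rw [hhit, ← huniq π hπ j, ENNReal.ofReal_mul (p := (π j : ℝ)) (π j).2,
        ENNReal.ofReal_coe_nnreal]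
    simp only [e]
    rw [← ENNReal.ofReal_sum_of_nonneg fun j _ => mul_nonneg (by positivity) (hnn _ _), hκ,
      ENNReal.ofReal_eq_coe_nnreal hκ0]
    rfl

end Walk

/-! ### Volumes, resistances and energies of 1-sums -/

section OneSum

variable {V₁ V₂ : Type*}

/-- The projection of the 1-sum onto the first graph, which contracts the second graph. -/
def toLeft (v₁ : V₁) : OneSumVert v₁ V₂ → V₁
  | .inl x => x
  | .inr _ => v₁

/-- The projection of the 1-sum onto the second graph, which contracts the first graph. -/
def toRight (v₁ : V₁) (v₂ : V₂) : OneSumVert v₁ V₂ → V₂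
  | .inl _ => v₂
  | .inr y => y

open scoped Classical in
/-- The embedding of the first graph into the 1-sum. -/
def ofLeft (v₁ : V₁) (v₂ : V₂) (x : V₁) : OneSumVert v₁ V₂ :=
  if h : x = v₁ then .inr v₂ else .inl ⟨x, h⟩

/-- The resistances of a 1-sum, in terms of those of the summands. -/
def oneSumResistance (R₁ : V₁ → V₁ → ℝ) (v₁ : V₁) (R₂ : V₂ → V₂ → ℝ) (v₂ : V₂)
    (z z' : OneSumVert v₁ V₂) : ℝ :=
  R₁ (toLeft v₁ z) (toLeft v₁ z') + R₂ (toRight v₁ v₂ z) (toRight v₁ v₂ z')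

@[simp] lemma toLeft_inr (v₁ : V₁) (y : V₂) : toLeft v₁ (.inr y : OneSumVert v₁ V₂) = v₁ := rfl

@[simp] lemma toRight_inr (v₁ : V₁) (v₂ y : V₂) :
    toRight v₁ v₂ (.inr y : OneSumVert v₁ V₂) = y := rfl

lemma ofLeft_self (v₁ : V₁) (v₂ : V₂) : ofLeft v₁ v₂ v₁ = .inr v₂ := by simp [ofLeft]

lemma ofLeft_coe (v₁ : V₁) (v₂ : V₂) (x : {x : V₁ // x ≠ v₁}) : ofLeft v₁ v₂ x = .inl x := by
  simp [ofLeft, x.2]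

@[simp] lemma toLeft_ofLeft (v₁ : V₁) (v₂ : V₂) (x : V₁) : toLeft v₁ (ofLeft v₁ v₂ x) = x := by
  unfold ofLeft
  split_ifs with h
  · exact h.symm
  · rfl

@[simp] lemma toRight_ofLeft (v₁ : V₁) (v₂ : V₂) (x : V₁) :
    toRight v₁ v₂ (ofLeft v₁ v₂ x) = v₂ := by
  unfold ofLeft
  split_ifs <;> rfl

lemma ofLeft_adj_ofLeft {G₁ : SimpleGraph V₁} {v₁ : V₁} {G₂ : SimpleGraph V₂} {v₂ : V₂} {x y : V₁}
    (h : G₁.Adj x y) : (oneSum G₁ v₁ G₂ v₂).Adj (ofLeft v₁ v₂ x) (ofLeft v₁ v₂ y) := by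
  by_cases hx : x = v₁ <;> by_cases hy : y = v₁
  · subst hx hy; exact absurd h (G₁.irrefl)
  · subst hx
    simp only [ofLeft, dif_pos, dif_neg hy]
    exact ⟨h.symm, rfl⟩
  · subst hy
    simp only [ofLeft, dif_pos, dif_neg hx]
    exact ⟨h, rfl⟩
  · simp only [ofLeft, dif_neg hx, dif_neg hy]
    exact h

lemma connected_oneSum {G₁ : SimpleGraph V₁} (v₁ : V₁) {G₂ : SimpleGraph V₂} (v₂ : V₂)
    (h₁ : G₁.Connected) (h₂ : G₂.Connected) : (oneSum G₁ v₁ G₂ v₂).Connected := by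
  let f₁ : G₁ →g oneSum G₁ v₁ G₂ v₂ := ⟨ofLeft v₁ v₂, ofLeft_adj_ofLeft⟩
  let f₂ : G₂ →g oneSum G₁ v₁ G₂ v₂ := ⟨.inr, fun h => h⟩
  rw [SimpleGraph.connected_iff_exists_forall_reachable]
  refine ⟨.inr v₂, ?_⟩
  rintro (x | y)
  · have := (h₁.preconnected v₁ x).map f₁
    simpa only [f₁, RelHom.coeFn_mk, ofLeft_self, ofLeft_coe] using this
  · exact (h₂.preconnected v₂ y).map f₂

lemma oneSum_sup_edge (G₁ : SimpleGraph V₁) (v₁ : V₁) (G₂ : SimpleGraph V₂) (v₂ a b : V₂) :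
    oneSum G₁ v₁ G₂ v₂ ⊔ SimpleGraph.edge (.inr a) (.inr b) =
      oneSum G₁ v₁ (G₂ ⊔ SimpleGraph.edge a b) v₂ := by
  ext z z'
  rcases z with x | x <;> rcases z' with y | y <;>
    simp [oneSum, SimpleGraph.edge_adj]

variable [Fintype V₁] [DecidableEq V₁] [Fintype V₂]

/-- Each edge of the 1-sum comes from exactly one summand. The facts below on volume, resistance and
energy reduce to this splitting. -/
lemma edgeSum_oneSum (G₁ : SimpleGraph V₁) (v₁ : V₁) (G₂ : SimpleGraph V₂) (v₂ : V₂)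
    (F : OneSumVert v₁ V₂ → OneSumVert v₁ V₂ → ℝ) :
    edgeSum (oneSum G₁ v₁ G₂ v₂) F =
      edgeSum G₁ (fun x y => F (ofLeft v₁ v₂ x) (ofLeft v₁ v₂ y)) +
        edgeSum G₂ (fun x y => F (.inr x) (.inr y)) := by
  classical
  have hll : ∀ x y : {x : V₁ // x ≠ v₁},
      (oneSum G₁ v₁ G₂ v₂).Adj (.inl x) (.inl y) ↔ G₁.Adj x y := fun _ _ => Iff.rfl
  have hlr : ∀ (x : {x : V₁ // x ≠ v₁}) (y : V₂),
      (oneSum G₁ v₁ G₂ v₂).Adj (.inl x) (.inr y) ↔ y = v₂ ∧ G₁.Adj x v₁ := fun _ _ => and_comm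
  have hrl : ∀ (x : V₂) (y : {x : V₁ // x ≠ v₁}),
      (oneSum G₁ v₁ G₂ v₂).Adj (.inr x) (.inl y) ↔ x = v₂ ∧ G₁.Adj v₁ y := fun _ _ => by
    rw [G₁.adj_comm]; exact and_comm
  have hrr : ∀ x y : V₂, (oneSum G₁ v₁ G₂ v₂).Adj (.inr x) (.inr y) ↔ G₂.Adj x y :=
    fun _ _ => Iff.rfl
  simp only [edgeSum, Fintype.sum_sum_type, hll, hlr, hrl, hrr, ite_and, Finset.sum_add_distrib,
    Finset.sum_ite_eq', Finset.mem_univ, if_true, Fintype.sum_eq_add_sum_subtype_ne _ v₁,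
    ofLeft_self, ofLeft_coe, SimpleGraph.irrefl, if_false, zero_add]
  rw [Finset.sum_comm (s := (Finset.univ : Finset V₂))]
  simp only [Finset.sum_ite_eq', Finset.mem_univ, if_true]
  ring

lemma vol_oneSum (G₁ : SimpleGraph V₁) (v₁ : V₁) (G₂ : SimpleGraph V₂) (v₂ : V₂)
    (f : OneSumVert v₁ V₂ → ℝ) :
    vol (oneSum G₁ v₁ G₂ v₂) f =
      vol G₁ (fun x => f (ofLeft v₁ v₂ x)) + vol G₂ (fun x => f (.inr x)) :=
  edgeSum_oneSum _ _ _ _ _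

lemma isResistance_oneSum {G₁ : SimpleGraph V₁} {R₁ : V₁ → V₁ → ℝ} (h₁ : IsResistance G₁ R₁)
    (v₁ : V₁) {G₂ : SimpleGraph V₂} {R₂ : V₂ → V₂ → ℝ} (h₂ : IsResistance G₂ R₂) (v₂ : V₂) :
    IsResistance (oneSum G₁ v₁ G₂ v₂) (oneSumResistance R₁ v₁ R₂ v₂) := by
  refine ⟨fun k => by simp [oneSumResistance, h₁.diag, h₂.diag], ?_⟩
  obtain ⟨c₁, hc₁⟩ := h₁.weak
  obtain ⟨c₂, hc₂⟩ := h₂.weak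
  -- On whichever side `k` lies, the other projection sends it to the glued vertex; this yields the
  -- same `-2 * φ (.inr v₂)` in both cases.
  refine ⟨fun φ => c₁ (fun x => φ (ofLeft v₁ v₂ x)) + c₂ (fun y => φ (.inr y)) -
    2 * φ (.inr v₂), fun φ k => ?_⟩
  simp only [edgeSum_oneSum, oneSumResistance, toLeft_ofLeft, toRight_ofLeft, toLeft_inr,
    toRight_inr, add_sub_add_right_eq_sub, add_sub_add_left_eq_sub]
  rw [hc₁ (fun x => φ (ofLeft v₁ v₂ x)), hc₂ (fun y => φ (.inr y))]
  rcases k with k | k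
  · simp only [toLeft, toRight, ofLeft_coe]
    ring
  · simp only [toLeft, toRight, ofLeft_self]
    ring

/-- Resistances add through a cut vertex. Pairs on opposite sides, taken in both orders, produce the
two symmetrised middle terms. -/
lemma energy_oneSum (G₁ : SimpleGraph V₁) {R₁ : V₁ → V₁ → ℝ} (v₁ : V₁) (h₁ : R₁ v₁ v₁ = 0)
    (G₂ : SimpleGraph V₂) {R₂ : V₂ → V₂ → ℝ} (v₂ : V₂) (h₂ : R₂ v₂ v₂ = 0) :
    energy (oneSum G₁ v₁ G₂ v₂) (oneSumResistance R₁ v₁ R₂ v₂) =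
      energy G₁ R₁ + vol G₂ 1 * vol G₁ (fun x => R₁ x v₁ + R₁ v₁ x) +
        vol G₁ 1 * vol G₂ (fun y => R₂ y v₂ + R₂ v₂ y) + energy G₂ R₂ := by
  simp only [energy, vol_oneSum, oneSumResistance, toLeft_ofLeft, toRight_ofLeft, toLeft_inr,
    toRight_inr, h₁, h₂, vol_add, vol_const]
  simp only [mul_comm _ (vol _ 1), vol_mul]
  ring

end OneSum

/-! ### Existence of resistances; effect of a new edge -/

section Resistance

variable {V : Type*} [Fintype V]

lemma edgeSum_eq (G : SimpleGraph V) [DecidableRel G.Adj] (F : V → V → ℝ) :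
    edgeSum G F = ∑ x, ∑ y, if G.Adj x y then F x y else 0 := by
  unfold edgeSum
  congr!

lemma isResistance_of_laplacian [DecidableEq V] {G : SimpleGraph V} [DecidableRel G.Adj] {R : V → V → ℝ} (hR : ∀ k, R k k = 0)
    (c : V → ℝ) (hc : ∀ i k, (∑ y, if G.Adj i y then R i k - R y k else 0) =
      c i - 2 * if i = k then 1 else 0) : IsResistance G R := by
  refine ⟨hR, fun φ => ∑ i, φ i * c i, fun φ k => ?_⟩
  have h : edgeSum G (fun x y => φ x * (R x k - R y k)) =
      ∑ i, φ i * (c i - 2 * if i = k then 1 else 0) := by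
    refine (edgeSum_eq _ _).trans (Finset.sum_congr rfl fun i _ => ?_)
    rw [← hc, Finset.mul_sum]
    exact Finset.sum_congr rfl fun y _ => by split_ifs <;> simp
  rw [h]
  simp [mul_sub, Finset.sum_sub_distrib, mul_comm]

open scoped Classical in
/-- The Laplacian of `G` plus the all-ones matrix. -/
def laplacianAddOnes (G : SimpleGraph V) : (V → ℝ) →ₗ[ℝ] (V → ℝ) where
  toFun f i := (∑ y, if G.Adj i y then f i - f y else 0) + ∑ y, f y
  map_add' f g := by
    funext i
    simp only [Pi.add_apply, ← Finset.sum_add_distrib]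
    refine Finset.sum_congr rfl fun y _ => ?_
    split_ifs <;> ring
  map_smul' c f := by
    funext i
    simp only [Pi.smul_apply, smul_eq_mul, RingHom.id_apply, mul_add, Finset.mul_sum, mul_ite,
      mul_zero, mul_sub]

open scoped Classical in
lemma sum_laplacian (G : SimpleGraph V) (f : V → ℝ) :
    (∑ i, ∑ y, if G.Adj i y then f i - f y else 0) = 0 := by
  have h := edgeSum_swap G fun x y => f x - f y
  have h' := edgeSum_mul G (-1) fun x y => f x - f y
  have e : (fun x y => f y - f x) = fun x y => -1 * (f x - f y) := by funext x y; ring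
  rw [e, h'] at h
  change edgeSum G (fun x y => f x - f y) = 0
  linarith

/-- Summing the coordinates of a kernel vector kills the Laplacian part, so its sum is 0. Then its
Laplacian is 0, its Dirichlet energy vanishes, and it is constant by connectedness. -/
lemma laplacianAddOnes_injective {G : SimpleGraph V} (hG : G.Connected) :
    Function.Injective (laplacianAddOnes G) := by
  classical
  have := hG.nonempty
  rw [← LinearMap.ker_eq_bot, LinearMap.ker_eq_bot']
  intro f hf
  have hf' : ∀ i, (∑ y, if G.Adj i y then f i - f y else 0) + ∑ y, f y = 0 := fun i =>
    congrFun hf i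
  have hs : ∑ y, f y = 0 := by
    have h := Finset.sum_congr rfl fun i (_ : i ∈ Finset.univ) => hf' i
    rw [Finset.sum_add_distrib, sum_laplacian] at h
    simpa using h
  have hL : ∀ i, (∑ y, if G.Adj i y then f i - f y else 0) = 0 := fun i => by
    have := hf' i
    rwa [hs, add_zero] at this
  have h1 : edgeSum G (fun x y => f x * (f x - f y)) = 0 := by
    have : edgeSum G (fun x y => f x * (f x - f y)) =
        ∑ i, f i * ∑ y, if G.Adj i y then f i - f y else 0 := by
      simp only [edgeSum, Finset.mul_sum, mul_ite, mul_zero]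
    simp [this, hL]
  have h2 : edgeSum G (fun x y => (f x - f y) ^ 2) = 0 := by
    have e : (fun x y => (f x - f y) ^ 2) =
        fun x y => f x * (f x - f y) + f y * (f y - f x) := by funext x y; ring
    rw [e, edgeSum_add, edgeSum_swap G fun x y => f x * (f x - f y), h1, add_zero]
  have h3 : ∀ x y, G.Adj x y → f x = f y := by
    intro x y hxy
    have hnn : ∀ x y, 0 ≤ if G.Adj x y then (f x - f y) ^ 2 else 0 := fun x y => by
      split_ifs <;> positivity
    have h4 := (Finset.sum_eq_zero_iff_of_nonneg
      fun x _ => Finset.sum_nonneg fun y _ => hnn x y).1 h2 x (Finset.mem_univ x)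
    have h5 := (Finset.sum_eq_zero_iff_of_nonneg fun y _ => hnn x y).1 h4 y (Finset.mem_univ y)
    rw [if_pos hxy] at h5
    linarith [pow_eq_zero_iff (two_ne_zero) |>.1 h5]
  have h4 : ∀ x y, f x = f y := fun x y => by
    obtain ⟨p⟩ := hG.preconnected x y
    induction p with
    | nil => rfl
    | cons h _ ih => exact (h3 _ _ h).trans ih
  funext x
  have h5 : ∑ y, f y = Fintype.card V * f x := by
    rw [Finset.sum_congr rfl fun y _ => h4 y x]
    simp
  rw [hs] at h5
  have h6 : (Fintype.card V : ℝ) ≠ 0 := by exact_mod_cast Fintype.card_ne_zero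
  exact (mul_eq_zero.1 h5.symm).resolve_left h6

/-- Every finite connected graph has a resistance function. -/
theorem exists_isResistance {G : SimpleGraph V} (hG : G.Connected) :
    ∃ R : V → V → ℝ, IsResistance G R := by
  classical
  have := hG.nonempty
  have hcard : (Fintype.card V : ℝ) ≠ 0 := by exact_mod_cast Fintype.card_ne_zero
  have hsurj := LinearMap.injective_iff_surjective.1 (laplacianAddOnes_injective hG)
  -- The right side sums to 0 over `i`, so each solution has sum 0 and the all-ones term drops out.
  choose f hf using fun k : V =>
    hsurj fun i => 2 / (Fintype.card V : ℝ) - 2 * if i = k then 1 else 0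
  have hf' : ∀ k i, (∑ y, if G.Adj i y then f k i - f k y else 0) + ∑ y, f k y =
      2 / (Fintype.card V : ℝ) - 2 * if i = k then 1 else 0 := fun k i => congrFun (hf k) i
  refine ⟨fun i k => f k i - f k k, isResistance_of_laplacian (fun k => sub_self _)
    (fun _ => 2 / (Fintype.card V : ℝ)) fun i k => ?_⟩
  have hs : ∑ y, f k y = 0 := by
    have h := Finset.sum_congr rfl fun i (_ : i ∈ Finset.univ) => hf' k i
    rw [Finset.sum_add_distrib, sum_laplacian, Finset.sum_sub_distrib, ← Finset.mul_sum] at h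
    simp only [Finset.sum_const, Finset.card_univ, nsmul_eq_mul, Finset.sum_ite_eq',
      Finset.mem_univ, if_true, zero_add] at h
    have h' : (Fintype.card V : ℝ) * ∑ y, f k y = 0 := by
      rw [h]; field_simp; ring
    exact (mul_eq_zero.1 h').resolve_left hcard
  rw [← hf' k i, hs, add_zero]
  exact Finset.sum_congr rfl fun y _ => by rw [sub_sub_sub_cancel_right]

lemma edgeSum_sup_edge (G : SimpleGraph V) {a b : V} (hab : a ≠ b) (h : ¬ G.Adj a b)
    (F : V → V → ℝ) : edgeSum (G ⊔ SimpleGraph.edge a b) F = edgeSum G F + F a b + F b a := by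
  classical
  have e : ∀ x y, (if (G ⊔ SimpleGraph.edge a b).Adj x y then F x y else 0) =
      (if G.Adj x y then F x y else 0) + (if x = a then if y = b then F x y else 0 else 0) +
        (if x = b then if y = a then F x y else 0 else 0) := by
    intro x y
    by_cases h1 : x = a ∧ y = b
    · obtain ⟨rfl, rfl⟩ := h1
      simp [SimpleGraph.edge_adj, hab, h]
    · by_cases h2 : x = b ∧ y = a
      · obtain ⟨rfl, rfl⟩ := h2
        simp [SimpleGraph.edge_adj, hab, hab.symm, mt SimpleGraph.Adj.symm h]
      · have h3 : (G ⊔ SimpleGraph.edge a b).Adj x y ↔ G.Adj x y := by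
          simp [SimpleGraph.edge_adj, h1, h2]
        simp only [h3, ← ite_and, h1, h2, if_false, add_zero]
  simp only [edgeSum_eq, e, Finset.sum_add_distrib]
  rw [Finset.sum_eq_single a (f := fun x => ∑ y, if x = a then if y = b then F x y else 0 else 0),
    Finset.sum_eq_single b (f := fun x => ∑ y, if x = b then if y = a then F x y else 0 else 0)] <;>
    simp +contextual

lemma vol_sup_edge (G : SimpleGraph V) {a b : V} (hab : a ≠ b) (h : ¬ G.Adj a b) :
    vol (G ⊔ SimpleGraph.edge a b) 1 = vol G 1 + 2 := by
  unfold vol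
  rw [edgeSum_sup_edge G hab h]
  simp only [Pi.one_apply]
  ring

lemma energy_le (G : SimpleGraph V) {R : V → V → ℝ} {C : ℝ} (hR : ∀ x y, R x y ≤ C) :
    energy G R ≤ C * vol G 1 ^ 2 := by
  have h : ∀ x, vol G (fun y => R x y) ≤ C * vol G 1 := fun x => by
    rw [← vol_const]; exact vol_mono _ (hR x)
  calc energy G R ≤ vol G (fun _ => C * vol G 1) := vol_mono _ h
    _ = _ := by rw [vol_const]; ring

lemma vol_nonneg (G : SimpleGraph V) {f : V → ℝ} (hf : ∀ x, 0 ≤ f x) : 0 ≤ vol G f := by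
  have := vol_mono G hf
  rwa [vol_const, zero_mul] at this

end Resistance

/-! ### Complete graphs -/

section Clique

/-- The resistances of a complete graph. -/
def cliqueResistance (n : ℕ) (x y : Fin n) : ℝ := if x = y then 0 else 2 / n

lemma sum_top_adj {n : ℕ} (i : Fin n) (f : Fin n → ℝ) :
    (∑ y, if (⊤ : SimpleGraph (Fin n)).Adj i y then f y else 0) = (∑ y, f y) - f i := by
  rw [eq_sub_iff_add_eq, ← Finset.sum_erase_add _ f (Finset.mem_univ i), ← Finset.sum_filter]
  congr 1
  refine Finset.sum_congr ?_ fun _ _ => rfl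
  ext y
  simp [eq_comm]

lemma isResistance_cliqueResistance (n : ℕ) [NeZero n] :
    IsResistance (⊤ : SimpleGraph (Fin n)) (cliqueResistance n) := by
  classical
  have hn : (n : ℝ) ≠ 0 := by exact_mod_cast NeZero.ne n
  refine isResistance_of_laplacian (fun k => by simp [cliqueResistance]) (fun _ => 2 / n)
    fun i k => ?_
  have e : ∀ y, cliqueResistance n y k = 2 / n - if y = k then 2 / (n : ℝ) else 0 := by
    intro y
    unfold cliqueResistance
    split_ifs <;> simp
  rw [sum_top_adj i fun y => cliqueResistance n i k - cliqueResistance n y k, sub_self, sub_zero,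
    Finset.sum_sub_distrib]
  simp only [e, Finset.sum_sub_distrib, Finset.sum_const, Finset.card_univ, Fintype.card_fin,
    nsmul_eq_mul, Finset.sum_ite_eq', Finset.mem_univ, if_true]
  split_ifs <;> field_simp <;> ring

lemma cliqueResistance_nonneg (n : ℕ) (x y : Fin n) : 0 ≤ cliqueResistance n x y := by
  unfold cliqueResistance
  split_ifs <;> positivity

lemma vol_clique (n : ℕ) : vol (⊤ : SimpleGraph (Fin n)) 1 = n * (n - 1) := by
  classical
  have h : vol (⊤ : SimpleGraph (Fin n)) 1 = ∑ i : Fin n, ((∑ _y : Fin n, (1 : ℝ)) - 1) :=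
    (edgeSum_eq _ _).trans (Finset.sum_congr rfl fun i _ => sum_top_adj i fun _ => 1)
  simp [h, mul_sub]

end Clique

/-! ### Paths -/

section Path

/-- The resistances of a path. -/
def pathResistance (n : ℕ) (x y : Fin n) : ℝ := |(x : ℝ) - (y : ℝ)|

open scoped Classical in
lemma sum_pathGraph_adj {n : ℕ} (i : Fin n) (g : ℕ → ℝ) :
    (∑ y, if (SimpleGraph.pathGraph n).Adj i y then g y else 0) =
      (if (i : ℕ) + 1 < n then g (i + 1) else 0) + if 0 < (i : ℕ) then g (i - 1) else 0 := by
  have hi := i.2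
  have e : ∀ y : ℕ, (if (i : ℕ) + 1 = y ∨ y + 1 = i then g y else 0) =
      (if (i : ℕ) + 1 = y then g y else 0) +
        if (i : ℕ) - 1 = y then if 0 < (i : ℕ) then g y else 0 else 0 := by
    intro y
    split_ifs <;> first | omega | simp
  simp only [SimpleGraph.pathGraph_adj]
  rw [Fin.sum_univ_eq_sum_range (fun y => if (i : ℕ) + 1 = y ∨ y + 1 = i then g y else 0)]
  simp only [e, Finset.sum_add_distrib, Finset.sum_ite_eq, Finset.mem_range]
  rw [if_pos (show (i : ℕ) - 1 < n by omega)]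

lemma isResistance_pathResistance (n : ℕ) :
    IsResistance (SimpleGraph.pathGraph n) (pathResistance n) := by
  classical
  -- The constant is `2 - deg i`: the steps ±1 cancel at interior vertices other than `k`, and an
  -- endpoint lacks one of them.
  refine isResistance_of_laplacian (fun k => by simp [pathResistance])
    (fun i => 2 - (if (i : ℕ) + 1 < n then 1 else 0) - if 0 < (i : ℕ) then 1 else 0) fun i k => ?_
  have hk := k.2
  have hi := i.2
  rw [show (∑ y, if (SimpleGraph.pathGraph n).Adj i y then
      pathResistance n i k - pathResistance n y k else 0) = _ from
    sum_pathGraph_adj i fun y => |(i : ℝ) - (k : ℝ)| - |(y : ℝ) - (k : ℝ)|]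
  have hr : |(i : ℝ) - (k : ℝ)| - |((i + 1 : ℕ) : ℝ) - (k : ℝ)| =
      if (i : ℕ) < k then 1 else -1 := by
    push_cast
    split_ifs with h
    · have : (i : ℝ) + 1 ≤ k := by exact_mod_cast h
      rw [abs_of_nonpos (by linarith), abs_of_nonpos (by linarith)]
      ring
    · have : (k : ℝ) ≤ i := by exact_mod_cast not_lt.1 h
      rw [abs_of_nonneg (by linarith), abs_of_nonneg (by linarith)]
      ring
  have hl : 0 < (i : ℕ) → |(i : ℝ) - (k : ℝ)| - |((i - 1 : ℕ) : ℝ) - (k : ℝ)| =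
      if (k : ℕ) < i then 1 else -1 := by
    intro h0
    rw [Nat.cast_sub h0, Nat.cast_one]
    split_ifs with h
    · have : (k : ℝ) + 1 ≤ i := by exact_mod_cast h
      rw [abs_of_nonneg (by linarith), abs_of_nonneg (by linarith)]
      ring
    · have : (i : ℝ) ≤ k := by exact_mod_cast not_lt.1 h
      rw [abs_of_nonpos (by linarith), abs_of_nonpos (by linarith)]
      ring
  have hl' : (if 0 < (i : ℕ) then |(i : ℝ) - (k : ℝ)| - |((i - 1 : ℕ) : ℝ) - (k : ℝ)| else 0) =
      if 0 < (i : ℕ) then if (k : ℕ) < i then (1 : ℝ) else -1 else 0 := by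
    split_ifs with h h' <;> simp_all
  rw [hr, hl']
  simp only [Fin.ext_iff]
  split_ifs <;> first | omega | norm_num

lemma vol_pathGraph_le (n : ℕ) : vol (SimpleGraph.pathGraph n) 1 ≤ 2 * n := by
  classical
  have h : ∀ i : Fin n, (∑ y, if (SimpleGraph.pathGraph n).Adj i y then (1 : ℝ) else 0) ≤ 2 := by
    intro i
    rw [sum_pathGraph_adj i fun _ => 1]
    split_ifs <;> norm_num
  calc vol (SimpleGraph.pathGraph n) 1 ≤ ∑ _i : Fin n, (2 : ℝ) :=
        (edgeSum_eq _ _).le.trans (Finset.sum_le_sum fun i _ => h i)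
    _ = 2 * n := by simp [mul_comm]

end Path

/-! ### Estimates for K_n ⊕ P_n -/

section CliquePath

variable (n : ℕ) [NeZero n]

/-- The resistances of `K_n ⊕ P_n`. -/
def cliquePathResistance : CliquePathVert n → CliquePathVert n → ℝ :=
  oneSumResistance (cliqueResistance n) 0 (pathResistance n) (Fin.rev 0)

lemma isResistance_cliquePathResistance :
    IsResistance (cliquePath n) (cliquePathResistance n) :=
  isResistance_oneSum (isResistance_cliqueResistance n) 0 (isResistance_pathResistance n) _

lemma connected_cliquePath : (cliquePath n).Connected := by
  have hP : (SimpleGraph.pathGraph n).Connected := by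
    obtain ⟨k, rfl⟩ := Nat.exists_eq_succ_of_ne_zero (NeZero.ne n)
    exact SimpleGraph.pathGraph_connected k
  exact connected_oneSum _ _ SimpleGraph.connected_top hP

lemma cliquePathResistance_nonneg (x y : CliquePathVert n) : 0 ≤ cliquePathResistance n x y :=
  add_nonneg (cliqueResistance_nonneg n _ _) (abs_nonneg _)

lemma cliquePathResistance_le (hn : 2 ≤ n) (x y : CliquePathVert n) :
    cliquePathResistance n x y ≤ n := by
  have hn' : (2 : ℝ) ≤ n := by exact_mod_cast hn
  have h1 : ∀ x y, cliqueResistance n x y ≤ 1 := fun x y => by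
    unfold cliqueResistance
    split_ifs
    · norm_num
    · rw [div_le_one (by linarith)]; exact hn'
  have h2 : ∀ x y, pathResistance n x y ≤ n - 1 := fun x y => by
    have hx : (x : ℝ) + 1 ≤ n := by exact_mod_cast x.2
    have hy : (y : ℝ) + 1 ≤ n := by exact_mod_cast y.2
    have hx0 : (0 : ℝ) ≤ x := by positivity
    have hy0 : (0 : ℝ) ≤ y := by positivity
    unfold pathResistance
    rw [abs_le]
    constructor <;> linarith
  calc cliquePathResistance n x y ≤ 1 + (n - 1) := add_le_add (h1 _ _) (h2 _ _)
    _ = n := by ring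

lemma vol_cliquePath :
    vol (cliquePath n) 1 = n * (n - 1) + vol (SimpleGraph.pathGraph n) 1 := by
  rw [← vol_clique]
  exact vol_oneSum _ _ _ _ _

/-- The clique alone suffices: its volume is n(n - 1), and its vertices all have resistance at least
n - 1 to the free end. The factor 2 counts both orders. -/
lemma le_vol_cliquePathResistance :
    2 * (n * (n - 1) ^ 2 : ℝ) ≤ vol (cliquePath n) fun x =>
      cliquePathResistance n x (freeEnd n) + cliquePathResistance n (freeEnd n) x := by
  have hn : (1 : ℝ) ≤ n := by exact_mod_cast NeZero.one_le
  have hrev : (((Fin.rev 0 : Fin n) : ℕ) : ℝ) = n - 1 := by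
    rw [Fin.val_rev, Nat.cast_sub (by simpa using NeZero.one_le)]
    simp
  have h1 : ∀ x : Fin n, 2 * ((n : ℝ) - 1) ≤
      cliquePathResistance n (ofLeft 0 (Fin.rev 0) x) (freeEnd n) +
        cliquePathResistance n (freeEnd n) (ofLeft 0 (Fin.rev 0) x) := by
    intro x
    simp only [cliquePathResistance, oneSumResistance, freeEnd, toLeft_ofLeft, toRight_ofLeft,
      toLeft_inr, toRight_inr, pathResistance, hrev]
    rw [abs_sub_comm]
    have h3 := cliqueResistance_nonneg n x 0
    have h4 := cliqueResistance_nonneg n 0 x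
    have h5 := neg_abs_le (((0 : Fin n) : ℝ) - (n - 1))
    have h6 : (((0 : Fin n) : ℕ) : ℝ) = 0 := by simp
    rw [h6] at h5 ⊢
    linarith
  have h2 := vol_mono (⊤ : SimpleGraph (Fin n)) h1
  rw [vol_const, vol_clique] at h2
  refine le_trans ?_ ((vol_oneSum _ _ _ _ _).symm.le)
  have h3 := vol_nonneg (SimpleGraph.pathGraph n) (f := fun x =>
    cliquePathResistance n (.inr x) (freeEnd n) + cliquePathResistance n (freeEnd n) (.inr x))
    fun x => add_nonneg (cliquePathResistance_nonneg n _ _) (cliquePathResistance_nonneg n _ _)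
  linarith

end CliquePath

/-! ### Comparison of Kemeny's constants -/

section Braess

/-- The comparison of the energies before (`D`) and after (`D'`) the addition of an edge, where `p`
and `q` are the volumes of the two summands. -/
lemma energy_comparison {N p q A D₁ B B' D D' : ℝ} (hp : 1 ≤ p) (hpN : p ≤ N * (N + 1))
    (hA : 2 * (N * (N - 1) ^ 2) ≤ A) (hD₁ : D₁ ≤ N * p ^ 2)
    (hN : |B' - B| + |B' * q - B * (q + 2) + D' - D| + |D' * q - D * (q + 2)| + 5 ≤ N) :
    (D₁ + q * A + p * B + D) * (p + q + 2) < (D₁ + (q + 2) * A + p * B' + D') * (p + q) := by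
  set X := B' - B with hX
  set Y := B' * q - B * (q + 2) + D' - D with hY
  set Z := D' * q - D * (q + 2) with hZ
  have e : (D₁ + (q + 2) * A + p * B' + D') * (p + q) - (D₁ + q * A + p * B + D) * (p + q + 2) =
      2 * p * A - 2 * D₁ + (p ^ 2 * X + p * Y + Z) := by
    simp only [hX, hY, hZ]; ring
  have hN5 : 5 ≤ N := by linarith [abs_nonneg X, abs_nonneg Y, abs_nonneg Z]
  have h1 : -(p ^ 2 * |X|) ≤ p ^ 2 * X := by
    have := mul_le_mul_of_nonneg_left (neg_abs_le X) (sq_nonneg p)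
    linarith
  have h2 : -(p ^ 2 * |Y|) ≤ p * Y := by
    have h3 := mul_le_mul_of_nonneg_left (neg_abs_le Y) (by linarith : 0 ≤ p)
    have h4 := mul_le_mul_of_nonneg_right (by nlinarith : p ≤ p ^ 2) (abs_nonneg Y)
    linarith
  have h3 : -(p ^ 2 * |Z|) ≤ Z := by
    have h4 := mul_le_mul_of_nonneg_right (by nlinarith : 1 ≤ p ^ 2) (abs_nonneg Z)
    linarith [neg_abs_le Z]
  have h4 : p ^ 2 * (|X| + |Y| + |Z|) ≤ p ^ 2 * (N - 5) :=
    mul_le_mul_of_nonneg_left (by linarith) (sq_nonneg p)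
  have h5 : 2 * p * (2 * (N * (N - 1) ^ 2)) ≤ 2 * p * A :=
    mul_le_mul_of_nonneg_left hA (by linarith)
  -- The losses `2 * D₁` and `h4` total at most `p ^ 2 * (3 * N - 5)`; one factor `p` is traded for
  -- its bound.
  have h6 : p * (p * (3 * N - 5)) ≤ p * (N * (N + 1) * (3 * N - 5)) :=
    mul_le_mul_of_nonneg_left (mul_le_mul_of_nonneg_right hpN (by linarith)) (by linarith)
  have h7 : 0 < p * (N * (4 * (N - 1) ^ 2 - (N + 1) * (3 * N - 5))) := by
    -- The difference is `(N - 3) ^ 2`.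
    have : 0 < 4 * (N - 1) ^ 2 - (N + 1) * (3 * N - 5) := by nlinarith
    have hN0 : 0 < N := by linarith
    have hp0 : 0 < p := by linarith
    positivity
  nlinarith

theorem exists_isBraessEdge_cliquePath {V : Type*} [Fintype V] {G : SimpleGraph V}
    (hG : G.Connected) (v : V) {a b : V} (hab : a ≠ b) (h : ¬ G.Adj a b) :
    ∃ N : ℕ, ∀ (n : ℕ) [NeZero n], N ≤ n →
      IsBraessEdge (oneSum (cliquePath n) (freeEnd n) G v) (.inr a) (.inr b) := by
  have hG' : (G ⊔ SimpleGraph.edge a b).Connected := hG.mono le_sup_left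
  obtain ⟨R, hR⟩ := exists_isResistance hG
  obtain ⟨R', hR'⟩ := exists_isResistance hG'
  set q := vol G 1 with hq
  set B := vol G fun y => R y v + R v y
  set B' := vol (G ⊔ SimpleGraph.edge a b) fun y => R' y v + R' v y
  set D := energy G R
  set D' := energy (G ⊔ SimpleGraph.edge a b) R'
  obtain ⟨N, hN⟩ := exists_nat_ge
    (|B' - B| + |B' * q - B * (q + 2) + D' - D| + |D' * q - D * (q + 2)| + 5)
  refine ⟨N, fun n _ hn => ⟨fun e => hab (Sum.inr_injective e), h, ?_⟩⟩
  rw [oneSum_sup_edge]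
  have hnt : Nontrivial (OneSumVert (freeEnd n) V) :=
    ⟨.inr a, .inr b, fun e => hab (Sum.inr_injective e)⟩
  have hR₁ := isResistance_cliquePathResistance n
  obtain ⟨κ, hκ, eκ⟩ := hasKemenyConstant_of_isResistance
    (connected_oneSum (freeEnd n) v (connected_cliquePath n) hG).preconnected.exists_adj_of_nontrivial
    (isResistance_oneSum hR₁ (freeEnd n) hR v)
  obtain ⟨κ', hκ', eκ'⟩ := hasKemenyConstant_of_isResistance
    (connected_oneSum (freeEnd n) v (connected_cliquePath n) hG').preconnected.exists_adj_of_nontrivial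
    (isResistance_oneSum hR₁ (freeEnd n) hR' v)
  refine ⟨κ, κ', hκ, hκ', ?_⟩
  rw [← NNReal.coe_lt_coe, eκ, eκ', energy_oneSum _ _ (hR₁.diag _) _ _ (hR.diag _),
    energy_oneSum _ _ (hR₁.diag _) _ _ (hR'.diag _)]
  have hvol : ∀ H : SimpleGraph V, vol (oneSum (cliquePath n) (freeEnd n) H v) 1 =
      vol (cliquePath n) 1 + vol H 1 := fun H => vol_oneSum _ _ _ _ _
  rw [hvol, hvol, vol_sup_edge G hab h, ← hq]
  have hNn : (N : ℝ) ≤ n := by exact_mod_cast hn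
  have h5 : (5 : ℝ) ≤ n := by
    linarith [abs_nonneg (B' - B), abs_nonneg (B' * q - B * (q + 2) + D' - D),
      abs_nonneg (D' * q - D * (q + 2))]
  have hq0 : 0 ≤ q := vol_nonneg _ fun _ => zero_le_one
  have hp := vol_cliquePath n
  have hP0 : 0 ≤ vol (SimpleGraph.pathGraph n) 1 := vol_nonneg _ fun _ => zero_le_one
  have hP1 := vol_pathGraph_le n
  have hp1 : 1 ≤ vol (cliquePath n) 1 := by nlinarith
  have key := energy_comparison (N := n) (q := q) (B := B) (B' := B') (D := D) (D' := D') hp1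
    (by nlinarith) (le_vol_cliquePathResistance n)
    (energy_le _ (cliquePathResistance_le n (by exact_mod_cast (by linarith : (2 : ℝ) ≤ n))))
    (hN.trans hNn)
  rw [div_lt_div_iff₀ (by linarith) (by linarith)]
  linarith

end Braess

end Kemeny

end

theorem mainTheorem7 {V₂ : Type*} [Fintype V₂] (G₂ : SimpleGraph V₂) (hG₂ : G₂.Connected) :
    (∀ v a b : V₂, a ≠ b → ¬ G₂.Adj a b →
      ∃ N : ℕ, ∀ (n : ℕ) [NeZero n], N ≤ n →
        Kemeny.IsBraessEdge (Kemeny.oneSum (Kemeny.cliquePath n) (Kemeny.freeEnd n) G₂ v)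
          (Sum.inr a) (Sum.inr b)) ∧
    (∃ (V₁ : Type) (_ : Fintype V₁) (_ : DecidableEq V₁) (G₁ : SimpleGraph V₁) (v₁ : V₁),
      G₁.Connected ∧
        ∀ v a b : V₂, a ≠ b → ¬ G₂.Adj a b →
          Kemeny.IsBraessEdge (Kemeny.oneSum G₁ v₁ G₂ v) (Sum.inr a) (Sum.inr b)) := by
  have h := fun v a b (hab : a ≠ b) (hadj : ¬ G₂.Adj a b) =>
    Kemeny.exists_isBraessEdge_cliquePath hG₂ v hab hadj
  refine ⟨h, ?_⟩
  choose! N hN using h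
  -- There are finitely many triples, so one index serves all; the `+ 1` ensures `M ≠ 0`.
  let M := (Finset.univ.sup fun t : V₂ × V₂ × V₂ => N t.1 t.2.1 t.2.2) + 1
  have : NeZero M := ⟨Nat.succ_ne_zero _⟩
  refine ⟨Kemeny.CliquePathVert M, inferInstance, inferInstance, Kemeny.cliquePath M,
    Kemeny.freeEnd M, Kemeny.connected_cliquePath M, fun v a b hab hadj => hN v a b hab hadj M ?_⟩
  exact (Finset.le_sup (f := fun t : V₂ × V₂ × V₂ => N t.1 t.2.1 t.2.2)
    (Finset.mem_univ (v, a, b))).trans (Nat.le_succ _)
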